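/- **Weak representation theorem.** Programs of arity $n$ are generated by the projections $\pi^n_i$, the zero function $Z^n$, the successor $Succ$, addition $+$, multiplication $\times$, the characteristic function $\chi_\le$ (with $\chi_\le(a,b)=1$ if $a\le b$ and $0$ otherwise), composition $\circ^n_m(h,g_1,\ldots,g_m)$ and minimization $\mu^n(g)$. A program $f$ of arity $n$ computes a partial function $\mathbb N^n\rightharpoonup\mathbb N$, also written $f$: a composition is defined where all the inner values and the outer one are, and $\mu^n(g)(p_1,\ldots,p_n)$ is the least $y$ such that $g(p_1,\ldots,p_n,y)=0$ and $g(p_1,\ldots,p_n,z)$ is defined for all $z<y$, if there is one. The proposition $A$ in the language $0,S,+,\times,=$, with free variables among $x_1,\ldots,x_n,y$, that represents a program of arity $n$ is defined by recursion on the program, where $x\le y$ abbreviates $\exists z\,(z+x=y)$ and $x<y$ abbreviates $S(x)\le y$: * $\pi^n_i$: $\;y=x_i$; $\quad Z^n$: $\;y=0$; $\quad Succ$: $\;y=S(x_1)$; $\quad +$: $\;y=x_1+x_2$; $\quad \times$: $\;y=x_1\times x_2$; * $\chi_\le$: $\;(x_1\le x_2\wedge y=1)\vee(x_2<x_1\wedge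 y=0)$; * $\circ^n_m(h,g_1,\ldots,g_m)$: $\;\exists w_1\cdots\exists w_m\,(B_1[x_1,\ldots,x_n,w_1]\wedge\cdots\wedge B_m[x_1,\ldots,x_n,w_m]\wedge C[w_1,\ldots,w_m,y])$, where $B_1,\ldots,B_m,C$ represent $g_1,\ldots,g_m,h$; * $\mu^n(g)$: $\;\forall z\,(z<y\Rightarrow\exists w\,B[x_1,\ldots,x_n,z,S(w)])\wedge B[x_1,\ldots,x_n,y,0]$, where $B$ represents $g$. Let $\mathcal T$ be a theory of classical first-order logic with equality, in a language containing $0,S,+,\times$, such that the set of axioms of $\mathcal T$ is decidable, $\mathcal T$ is an extension of Robinson's arithmetic (it proves the axioms of Robinson's arithmetic), and $\mathcal T$ has a standard model (a model with domain $\mathbb N$ in which $0,S,+,\times$ have their usual meaning). Let $f$ be a program of arity $n$ and let $A$ be the proposition that represents it. Then for all $p_1,\ldots,p_n,q\in\mathbb N$, writing $\underline{k}$ for the numeral $S^k(0)$, $$\mathcal T\vdash A[\underline{p_1},\ldots,\underline{p_n},\underline{q}]\quad\Longleftrightarrow\quad f \text{ is defined at } (p_1,\ldots,p_n) \text{ and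 } f(p_1,\ldots,p_n)=q .$$ -/

import Mathlib

open FirstOrder FirstOrder.Language

universe u v

namespace WeakRepresentation

/-! ## The language of arithmetic and its standard structure -/

/-- The function symbols `0`, `S`, `+`, `×` of arithmetic, with their arities. -/
inductive ArithFunc : ℕ → Type
  | zero : ArithFunc 0
  | succ : ArithFunc 1
  | add : ArithFunc 2
  | mul : ArithFunc 2

/-- The language `0, S, +, ×` of arithmetic. Equality is the logical equality of Mathlib's
first-order formulas; `≤` and `<` are abbreviations, see `leFormula` and `ltFormula`. -/
def arith : FirstOrder.Language.{0, 0} := ⟨ArithFunc, fun _ => Empty⟩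

/-- The standard interpretation of the symbols of arithmetic on `ℕ`. -/
instance standardStructure : arith.Structure ℕ where
  funMap := fun {_} f x =>
    match f, x with
    | ArithFunc.zero, _ => 0
    | ArithFunc.succ, x => x 0 + 1
    | ArithFunc.add, x => x 0 + x 1
    | ArithFunc.mul, x => x 0 * x 1
  RelMap := fun {_} r _ => Empty.elim r

/-! ## Terms and propositions with `n` free variables, and substitution -/

/-- Terms whose variables are among `&0, …, &(n-1)`. -/
abbrev Tm (L : FirstOrder.Language.{u, v}) (n : ℕ) : Type u := L.Term (Empty ⊕ Fin n)

/-- Propositions whose free variables are among `&0, …, &(n-1)`.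
`Fml L 0` is Mathlib's `L.Sentence`. -/
abbrev Fml (L : FirstOrder.Language.{u, v}) (n : ℕ) : Type (max u v) := L.BoundedFormula Empty n

section Substitution

variable {L : FirstOrder.Language.{u, v}} {n m : ℕ}

/-- The variable `&i`. -/
def vr (i : Fin n) : Tm L n := Term.var (Sum.inr i)

/-- A term in the variables `&0, …, &(n-1)`, seen as a term in `&0, …, &n`. -/
def Tm.weaken (t : Tm L n) : Tm L (n + 1) := t.relabel (Sum.map id Fin.castSucc)

/-- Simultaneous substitution of the terms `σ i` for the variables `&i` in a term. -/
def Tm.inst (σ : Fin n → Tm L m) (t : Tm L n) : Tm L m :=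
  t.subst (Sum.elim Empty.elim σ)

/-- Substitution below a quantifier: the variable bound by the quantifier is kept. -/
def liftSubst (σ : Fin n → Tm L m) : Fin (n + 1) → Tm L (m + 1) :=
  Fin.snoc (α := fun _ => Tm L (m + 1)) (fun i => (σ i).weaken) (vr (Fin.last m))

/-- Simultaneous, capture-avoiding substitution of the terms `σ i` for the free variables `&i`
in a proposition. In a proposition with `n` free variables `&0, …, &(n-1)` the
outermost quantifier binds `&n`. -/
def Fml.inst : {n m : ℕ} → (Fin n → Tm L m) → Fml L n → Fml L m
  | _, _, _, .falsum => .falsum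
  | _, _, σ, .equal t₁ t₂ => .equal (Tm.inst σ t₁) (Tm.inst σ t₂)
  | _, _, σ, .rel R ts => .rel R (fun i => Tm.inst σ (ts i))
  | _, _, σ, .imp A B => .imp (Fml.inst σ A) (Fml.inst σ B)
  | _, _, σ, .all A => .all (Fml.inst (liftSubst σ) A)

/-- A proposition in `&0, …, &(n-1)`, seen as a proposition in `&0, …, &n`. -/
def Fml.weaken (A : Fml L n) : Fml L (n + 1) :=
  Fml.inst (fun i => vr i.castSucc) A

/-- `(t / x) A`, where `x` is the last variable `&n` of `A`. -/
def Fml.instLast (t : Tm L n) (A : Fml L (n + 1)) : Fml L n :=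
  Fml.inst (Fin.snoc (α := fun _ => Tm L n) vr t) A

end Substitution

/-! ## Provability -/

/-- Classical natural deduction for first-order logic with equality: `Derivable T Γ A` says that
`A` is derivable from the axioms `T` and the hypotheses `Γ`. The variables
`&0, …, &(n-1)` free in `Γ` and `A` are arbitrary (eigenvariables). The primitive logical symbols
are those of Mathlib's formulas, `⊥`, `⟹`, `∀'` and `=`; the others are
classical abbreviations. -/
inductive Derivable {L : FirstOrder.Language.{u, v}} (T : L.Theory) :
    {n : ℕ} → List (Fml L n) → Fml L n → Prop
  | theoryAx {n : ℕ} {Γ : List (Fml L n)} {A : L.Sentence} (h : A ∈ T) :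
      Derivable T Γ (Fml.inst Fin.elim0 A)
  | hyp {n : ℕ} {Γ : List (Fml L n)} {A : Fml L n} (h : A ∈ Γ) : Derivable T Γ A
  | impIntro {n : ℕ} {Γ : List (Fml L n)} {A B : Fml L n} (h : Derivable T (A :: Γ) B) :
      Derivable T Γ (A.imp B)
  | impElim {n : ℕ} {Γ : List (Fml L n)} {A B : Fml L n}
      (h₁ : Derivable T Γ (A.imp B)) (h₂ : Derivable T Γ A) : Derivable T Γ B
  | byContra {n : ℕ} {Γ : List (Fml L n)} {A : Fml L n}
      (h : Derivable T (A.not :: Γ) BoundedFormula.falsum) : Derivable T Γ A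
  | allIntro {n : ℕ} {Γ : List (Fml L n)} {A : Fml L (n + 1)}
      (h : Derivable T (Γ.map Fml.weaken) A) : Derivable T Γ A.all
  | allElim {n : ℕ} {Γ : List (Fml L n)} {A : Fml L (n + 1)} (t : Tm L n)
      (h : Derivable T Γ A.all) : Derivable T Γ (Fml.instLast t A)
  | eqRefl {n : ℕ} {Γ : List (Fml L n)} (t : Tm L n) :
      Derivable T Γ (BoundedFormula.equal t t)
  | eqElim {n : ℕ} {Γ : List (Fml L n)} (A : Fml L (n + 1)) {t s : Tm L n}
      (h₁ : Derivable T Γ (BoundedFormula.equal t s))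
      (h₂ : Derivable T Γ (Fml.instLast t A)) : Derivable T Γ (Fml.instLast s A)

/-- The sentence `A` is provable in the theory `T`. -/
def Provable {L : FirstOrder.Language.{u, v}} (T : L.Theory) (A : L.Sentence) : Prop :=
  Derivable T (n := 0) [] A

/-! ## Terms and propositions of arithmetic -/

section Arithmetic

variable {n : ℕ}

/-- The term `0`. -/
def tZero : Tm arith n := Term.func (L := arith) ArithFunc.zero ![]

/-- The term `S(t)`. -/
def tSucc (t : Tm arith n) : Tm arith n := Term.func (L := arith) ArithFunc.succ ![t]

/-- The term `t + s`. -/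
def tAdd (t s : Tm arith n) : Tm arith n := Term.func (L := arith) ArithFunc.add ![t, s]

/-- The term `t × s`. -/
def tMul (t s : Tm arith n) : Tm arith n := Term.func (L := arith) ArithFunc.mul ![t, s]

/-- The numeral `S(S(⋯ S(0)))` with `k` occurrences of `S`. -/
def numeral : ℕ → Tm arith n
  | 0 => tZero
  | k + 1 => tSucc (numeral k)

/-- `t = s`. -/
def eqFormula (t s : Tm arith n) : Fml arith n := BoundedFormula.equal t s

/-- `t ≤ s`, that is `∃ z (z + t = s)`. -/
def leFormula (t s : Tm arith n) : Fml arith n :=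
  (eqFormula (tAdd (vr (Fin.last n)) t.weaken) s.weaken).ex

/-- `t < s`, that is `S(t) ≤ s`. -/
def ltFormula (t s : Tm arith n) : Fml arith n := leFormula (tSucc t) s

/-- `∃ w₁ ⋯ ∃ wₘ A`, where `w₁, …, wₘ` are the last `m` variables of `A`. -/
def exBlock {L : FirstOrder.Language.{u, v}} {k : ℕ} : (m : ℕ) → Fml L (k + m) → Fml L k
  | 0, A => A
  | m + 1, A => exBlock m (BoundedFormula.ex A)

end Arithmetic

/-- The axioms of Robinson's arithmetic. -/
def robinson : arith.Theory :=
  { -- `∀ x, ¬ S(x) = 0`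
    (eqFormula (tSucc (vr (0 : Fin 1))) tZero).not.all,
    -- `∀ x y, S(x) = S(y) ⟹ x = y`
    ((eqFormula (tSucc (vr (0 : Fin 2))) (tSucc (vr 1))).imp
      (eqFormula (vr 0) (vr 1))).all.all,
    -- `∀ x, x = 0 ∨ ∃ y, x = S(y)`
    (eqFormula (vr (0 : Fin 1)) tZero ⊔
      (eqFormula (vr (0 : Fin 2)) (tSucc (vr 1))).ex).all,
    -- `∀ x, x + 0 = x`
    (eqFormula (tAdd (vr (0 : Fin 1)) tZero) (vr 0)).all,
    -- `∀ x y, x + S(y) = S(x + y)`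
    (eqFormula (tAdd (vr (0 : Fin 2)) (tSucc (vr 1))) (tSucc (tAdd (vr 0) (vr 1)))).all.all,
    -- `∀ x, x × 0 = 0`
    (eqFormula (tMul (vr (0 : Fin 1)) tZero) tZero).all,
    -- `∀ x y, x × S(y) = (x × y) + x`
    (eqFormula (tMul (vr (0 : Fin 2)) (tSucc (vr 1)))
      (tAdd (tMul (vr 0) (vr 1)) (vr 0))).all.all }

/-! ## Programs -/

/-- Programs of arity `n`: constructions of computable functions. -/
inductive Program : ℕ → Type
  | proj {n : ℕ} (i : Fin n) : Program n
  | zero (n : ℕ) : Program n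
  | succ : Program 1
  | add : Program 2
  | mul : Program 2
  | chiLe : Program 2
  | comp {n m : ℕ} (h : Program m) (g : Fin m → Program n) : Program n
  | mu {n : ℕ} (g : Program (n + 1)) : Program n

namespace Program

/-- The partial function computed by a program. A composition is defined only where all the inner
values are; `mu g` takes at `x` the least `y` such that `g (x, y) = 0` and `g (x, z)` is defined
for all `z < y`, and is undefined if there is none. -/
def eval : {n : ℕ} → Program n → (Fin n → ℕ) → Part ℕ
  | _, proj i, x => Part.some (x i)
  | _, zero _, _ => Part.some 0
  | _, succ, x => Part.some (x 0 + 1)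
  | _, add, x => Part.some (x 0 + x 1)
  | _, mul, x => Part.some (x 0 * x 1)
  | _, chiLe, x => Part.some (if x 0 ≤ x 1 then 1 else 0)
  | _, comp (m := m) h g, x =>
      Part.bind (⟨∀ i, (eval (g i) x).Dom, fun d i => (eval (g i) x).get (d i)⟩ :
        Part (Fin m → ℕ)) (eval h)
  | _, mu g, x =>
      Nat.rfind fun y =>
        (eval g (Fin.snoc (α := fun _ => ℕ) x y)).map fun v => decide (v = 0)

/-- The proposition representing a program of arity `n`. The variables `x₁, …, xₙ` are
`&0, …, &(n-1)`, and `y` is `&n`. -/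
def formula : {n : ℕ} → Program n → Fml arith (n + 1)
  | n, proj i => eqFormula (vr (Fin.last n)) (vr i.castSucc)
  | n, zero _ => eqFormula (vr (Fin.last n)) tZero
  | _, succ => eqFormula (vr 1) (tSucc (vr 0))
  | _, add => eqFormula (vr 2) (tAdd (vr 0) (vr 1))
  | _, mul => eqFormula (vr 2) (tMul (vr 0) (vr 1))
  | _, chiLe =>
      (leFormula (vr 0) (vr 1) ⊓ eqFormula (vr 2) (numeral 1)) ⊔
        (ltFormula (vr 1) (vr 0) ⊓ eqFormula (vr 2) (numeral 0))
  | n, comp (m := m) h g =>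
      -- the variables of the body are `x₁, …, xₙ, y, w₁, …, wₘ`
      let x : Fin n → Tm arith (n + 1 + m) := fun j => vr (Fin.castAdd m j.castSucc)
      let y : Tm arith (n + 1 + m) := vr (Fin.castAdd m (Fin.last n))
      let w : Fin m → Tm arith (n + 1 + m) := fun i => vr (Fin.natAdd (n + 1) i)
      -- `∃ w₁ ⋯ ∃ wₘ (B₁[x₁, …, xₙ, w₁] ∧ ⋯ ∧ Bₘ[x₁, …, xₙ, wₘ] ∧ C[w₁, …, wₘ, y])`
      exBlock m
        (((List.finRange m).map fun i =>
            Fml.inst (Fin.snoc (α := fun _ => Tm arith (n + 1 + m)) x (w i))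
              (formula (g i))).foldr (· ⊓ ·)
          (Fml.inst (Fin.snoc (α := fun _ => Tm arith (n + 1 + m)) w y) (formula h)))
  | n, mu g =>
      -- `∀ z (z < y ⟹ ∃ w B[x₁, …, xₙ, z, S(w)]) ∧ B[x₁, …, xₙ, y, 0]`,
      -- with `y`, `z`, `w` the variables `&n`, `&(n+1)`, `&(n+2)`
      let x : {k : ℕ} → Fin n → Tm arith (n + k) := fun {k} j => vr (Fin.castAdd k j)
      ((ltFormula (vr (Fin.last (n + 1))) (vr (Fin.last n).castSucc)).imp
          (BoundedFormula.ex (n := n + 2)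
            (Fml.inst
              (Fin.snoc (α := fun _ => Tm arith (n + 3))
                (Fin.snoc (α := fun _ => Tm arith (n + 3)) (x (k := 3))
                  (vr (Fin.last (n + 1)).castSucc))
                (tSucc (vr (Fin.last (n + 2)))))
              (formula g)))).all ⊓
        Fml.inst
          (Fin.snoc (α := fun _ => Tm arith (n + 1))
            (Fin.snoc (α := fun _ => Tm arith (n + 1)) (x (k := 1)) (vr (Fin.last n)))
            tZero)
          (formula g)

end Program

/-- The sentence `A[p₁, …, pₙ, q]`, where the numerals of `p₁, …, pₙ, q` are substituted for
`x₁, …, xₙ, y` in `A`. -/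
def atNumerals {n : ℕ} (A : Fml arith (n + 1)) (p : Fin n → ℕ) (q : ℕ) : arith.Sentence :=
  Fml.inst (m := 0) (fun i => numeral (Fin.snoc (α := fun _ => ℕ) p q i)) A

/-! ## Theories with a decidable set of axioms -/

/-- An effective numbering of the symbols of a language: symbols of the same kind have distinct
numbers, and it is decidable whether `e` is the number of a symbol of arity `k`
(for a language with finitely many symbols, any injective numbering will do). -/
structure SymbolNumbering (L : FirstOrder.Language.{u, v}) where
  /-- The number of a function symbol. -/
  func : (Σ k, L.Functions k) → ℕ
  /-- The number of a predicate symbol. -/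
  rel : (Σ k, L.Relations k) → ℕ
  func_injective : Function.Injective func
  rel_injective : Function.Injective rel
  func_decidable : ComputablePred fun x : ℕ × ℕ => ∃ f : L.Functions x.1, func ⟨x.1, f⟩ = x.2
  rel_decidable : ComputablePred fun x : ℕ × ℕ => ∃ R : L.Relations x.1, rel ⟨x.1, R⟩ = x.2

section Numbering

variable {L : FirstOrder.Language.{u, v}} (ν : SymbolNumbering L)

/-- The number of a term: a tree is numbered by the list of the number of its label and those of
its immediate subtrees, lists of natural numbers being numbered by
iterating Cantor's pairing. -/
def termCode {n : ℕ} : Tm L n → ℕ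
  | .var (.inl e) => Empty.elim e
  | .var (.inr i) => Encodable.encode [0, (i : ℕ)]
  | .func f ts => Encodable.encode (1 :: ν.func ⟨_, f⟩ :: List.ofFn fun i => termCode (ts i))

/-- The number of a proposition. -/
def formulaCode : {n : ℕ} → Fml L n → ℕ
  | _, .falsum => Encodable.encode [0]
  | _, .equal t s => Encodable.encode [1, termCode ν t, termCode ν s]
  | _, .rel R ts =>
      Encodable.encode (2 :: ν.rel ⟨_, R⟩ :: List.ofFn fun i => termCode ν (ts i))
  | _, .imp A B => Encodable.encode [3, formulaCode A, formulaCode B]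
  | _, .all A => Encodable.encode [4, formulaCode A]

end Numbering

/-- The set of axioms of `T` is decidable: for an effective numbering of the symbols, the set of
the numbers of the axioms is a computable set of natural numbers. -/
def HasDecidableAxiomSet {L : FirstOrder.Language.{u, v}} (T : L.Theory) : Prop :=
  ∃ ν : SymbolNumbering L,
    ComputablePred fun k : ℕ => ∃ A : L.Sentence, A ∈ T ∧ formulaCode ν (n := 0) A = k

/-! ## Extensions of Robinson's arithmetic, and standard models -/

/-- The theory `T`, in a language `L` that contains the symbols of arithmetic through `ι`, is an
extension of Robinson's arithmetic: it proves all the axioms of the latter. -/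
def ExtendsRobinson {L : FirstOrder.Language.{u, v}} (ι : arith →ᴸ L) (T : L.Theory) : Prop :=
  ∀ A ∈ robinson, Provable T (ι.onSentence A)

/-- `T` has a standard model: a model with domain `ℕ` in which `0`, `S`, `+` and `×` have their
standard interpretation (the other symbols of `L` being interpreted in any way). -/
def HasStandardModel {L : FirstOrder.Language.{u, v}} (ι : arith →ᴸ L) (T : L.Theory) : Prop :=
  ∃ M : L.Structure ℕ,
    @LHom.IsExpansionOn arith L ι ℕ standardStructure M ∧ @Theory.Model L ℕ M T

end WeakRepresentation

/-! The two directions are independent.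

From provability to computation, no reasoning inside the theory is needed. Natural deduction is
sound (`Derivable.sound`), so a provable instance is true in the standard model, and in `ℕ` the
representing proposition defines exactly the graph of the program (`Program.holds_formula`).

From computation to provability, Robinson's arithmetic already proves every true instance
(`Derivable.formula_of_mem_eval`), by induction on the program, and the derivation carries over to
any theory proving the Robinson axioms (`Derivable.translate`). This works because the representing
propositions only make positive, finitely checkable claims: equations between numerals follow from
the recursion equations, existential quantifiers are witnessed by values of the computation,
"nonzero" is expressed as "is some `S(w)`", and universal quantifiers occur only in minimizations,
where they are bounded. Once the bound is a numeral `q`, Robinson's arithmetic reduces `z < q` to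
the finitely many cases `z = 0, …, q - 1` (`Derivable.cases_lt_numeral`), so the bounded
quantification follows from its instances (`Derivable.forall_lt_numeral`). -/

namespace WeakRepresentation

/-! ### Calculus of simultaneous substitutions. -/

section SubstitutionLemmas

variable {L : FirstOrder.Language.{u, v}} {n m k : ℕ}

@[simp] theorem Tm.inst_vr (σ : Fin n → Tm L m) (i : Fin n) : Tm.inst σ (vr i) = σ i := rfl

@[simp] theorem Tm.inst_inst (τ : Fin m → Tm L k) (σ : Fin n → Tm L m) (t : Tm L n) :
    Tm.inst τ (Tm.inst σ t) = Tm.inst (fun i => Tm.inst τ (σ i)) t := by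
  induction t with
  | var a => rcases a with e | i
             · exact e.elim
             · rfl
  | func f ts ih => exact congrArg (Term.func f) (funext ih)

theorem Tm.inst_eq_self (t : Tm L n) : Tm.inst vr t = t := by
  induction t with
  | var a => rcases a with e | i
             · exact e.elim
             · rfl
  | func f ts ih => exact congrArg (Term.func f) (funext ih)

theorem Tm.weaken_eq_inst (t : Tm L n) : t.weaken = Tm.inst (fun i => vr i.castSucc) t := by
  induction t with
  | var a => rcases a with e | i
             · exact e.elim
             · rfl
  | func f ts ih => exact congrArg (Term.func f) (funext ih)

@[simp] theorem liftSubst_castSucc (σ : Fin n → Tm L m) (i : Fin n) :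
    liftSubst σ i.castSucc = (σ i).weaken := by
  simp [liftSubst]

@[simp] theorem liftSubst_last (σ : Fin n → Tm L m) :
    liftSubst σ (Fin.last n) = vr (Fin.last m) := by
  simp [liftSubst]

@[simp] theorem Tm.inst_weaken (σ : Fin (n + 1) → Tm L m) (t : Tm L n) :
    Tm.inst σ t.weaken = Tm.inst (fun i => σ i.castSucc) t := by
  simp [Tm.weaken_eq_inst]

theorem Tm.weaken_inst (σ : Fin n → Tm L m) (t : Tm L n) :
    (Tm.inst σ t).weaken = Tm.inst (fun i => (σ i).weaken) t := by
  simp [Tm.weaken_eq_inst]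

theorem inst_liftSubst (τ : Fin m → Tm L k) (σ : Fin n → Tm L m) :
    (fun i => Tm.inst (liftSubst τ) (liftSubst σ i)) = liftSubst fun i => Tm.inst τ (σ i) := by
  funext i
  refine Fin.lastCases ?_ (fun j => ?_) i
  · simp
  · simp [Tm.weaken_inst]

@[simp] theorem Fml.inst_inst (τ : Fin m → Tm L k) (σ : Fin n → Tm L m) (A : Fml L n) :
    Fml.inst τ (Fml.inst σ A) = Fml.inst (fun i => Tm.inst τ (σ i)) A := by
  induction A generalizing m k with
  | falsum => rfl
  | equal t s => simp [Fml.inst]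
  | rel R ts => simp [Fml.inst]
  | imp A B ihA ihB => simp [Fml.inst, ihA, ihB]
  | all A ih => simp [Fml.inst, ih, inst_liftSubst]

theorem inst_snoc_liftSubst (τ : Fin m → Tm L k) (t : Tm L k) (σ : Fin n → Tm L m) :
    (fun i => Tm.inst (Fin.snoc (α := fun _ => Tm L k) τ t) (liftSubst σ i)) =
      Fin.snoc (α := fun _ => Tm L k) (fun i => Tm.inst τ (σ i)) t := by
  funext i
  refine Fin.lastCases ?_ (fun j => ?_) i
  · simp
  · simp

/-- Collapses a substitution pushed under a quantifier, followed by elimination of that quantifier,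
into one simultaneous substitution. Instances of quantified propositions are computed this way
throughout. -/
theorem Fml.instLast_inst_liftSubst (σ : Fin n → Tm L m) (t : Tm L m) (A : Fml L (n + 1)) :
    Fml.instLast t (Fml.inst (liftSubst σ) A) =
      Fml.inst (Fin.snoc (α := fun _ => Tm L m) σ t) A := by
  simp [Fml.instLast, inst_snoc_liftSubst, Tm.inst_eq_self]

theorem Tm.inst_comp_snoc (σ : Fin m → Tm L k) (τ : Fin n → Tm L m) (t : Tm L m) :
    (fun i => Tm.inst σ (Fin.snoc (α := fun _ => Tm L m) τ t i)) =
      Fin.snoc (α := fun _ => Tm L k) (fun i => Tm.inst σ (τ i)) (Tm.inst σ t) := by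
  funext i
  refine Fin.lastCases ?_ (fun j => ?_) i
  · simp
  · simp

theorem Fml.inst_instLast (σ : Fin n → Tm L m) (t : Tm L n) (A : Fml L (n + 1)) :
    Fml.inst σ (Fml.instLast t A) =
      Fml.instLast (Tm.inst σ t) (Fml.inst (liftSubst σ) A) := by
  rw [Fml.instLast_inst_liftSubst]
  simp [Fml.instLast, Tm.inst_comp_snoc]

theorem Fml.inst_liftSubst_weaken (σ : Fin n → Tm L m) (A : Fml L n) :
    Fml.inst (liftSubst σ) A.weaken = (Fml.inst σ A).weaken := by
  simp [Fml.weaken, Tm.weaken_eq_inst]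

theorem Fml.weaken_inst (σ : Fin n → Tm L m) (A : Fml L n) :
    (Fml.inst σ A).weaken = Fml.inst (fun i => (σ i).weaken) A := by
  simp [Fml.weaken, Tm.weaken_eq_inst]

@[simp] theorem Fml.inst_imp (σ : Fin n → Tm L m) (A B : Fml L n) :
    Fml.inst σ (A.imp B) = (Fml.inst σ A).imp (Fml.inst σ B) := rfl

@[simp] theorem Fml.inst_not (σ : Fin n → Tm L m) (A : Fml L n) :
    Fml.inst σ A.not = (Fml.inst σ A).not := rfl

@[simp] theorem Fml.inst_inf (σ : Fin n → Tm L m) (A B : Fml L n) :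
    Fml.inst σ (A ⊓ B) = Fml.inst σ A ⊓ Fml.inst σ B := rfl

@[simp] theorem Fml.inst_sup (σ : Fin n → Tm L m) (A B : Fml L n) :
    Fml.inst σ (A ⊔ B) = Fml.inst σ A ⊔ Fml.inst σ B := rfl

@[simp] theorem Fml.inst_all (σ : Fin n → Tm L m) (A : Fml L (n + 1)) :
    Fml.inst σ A.all = (Fml.inst (liftSubst σ) A).all := rfl

@[simp] theorem Fml.inst_ex (σ : Fin n → Tm L m) (A : Fml L (n + 1)) :
    Fml.inst σ A.ex = (Fml.inst (liftSubst σ) A).ex := rfl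

theorem Fml.inst_foldr_inf {ι : Type*} (σ : Fin n → Tm L m) (l : List ι) (F : ι → Fml L n)
    (D : Fml L n) :
    Fml.inst σ ((l.map F).foldr (· ⊓ ·) D) =
      (l.map fun i => Fml.inst σ (F i)).foldr (· ⊓ ·) (Fml.inst σ D) := by
  induction l with
  | nil => rfl
  | cons a l ih => simp only [List.map_cons, List.foldr_cons, Fml.inst_inf, ih]

end SubstitutionLemmas

/-! ### Compatibility of substitution with a change of language. -/

section Translation

variable {L : FirstOrder.Language.{u, v}} {L₀ : FirstOrder.Language.{0, 0}} {n m : ℕ}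

theorem onTerm_inst (ι : L₀ →ᴸ L) (σ : Fin n → Tm L₀ m) (t : Tm L₀ n) :
    ι.onTerm (Tm.inst σ t) = Tm.inst (fun i => ι.onTerm (σ i)) (ι.onTerm t) := by
  induction t with
  | var a => rcases a with e | i
             · exact e.elim
             · rfl
  | func f ts ih => exact congrArg (Term.func (ι.onFunction f)) (funext ih)

theorem onTerm_weaken (ι : L₀ →ᴸ L) (t : Tm L₀ n) :
    ι.onTerm t.weaken = Tm.weaken (ι.onTerm t) := by
  simp only [Tm.weaken_eq_inst, onTerm_inst]
  rfl

theorem onTerm_liftSubst (ι : L₀ →ᴸ L) (σ : Fin n → Tm L₀ m) :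
    (fun i => ι.onTerm (liftSubst σ i)) = liftSubst fun i => ι.onTerm (σ i) := by
  funext i
  refine Fin.lastCases ?_ (fun j => ?_) i
  · simp only [liftSubst_last]; rfl
  · simp only [liftSubst_castSucc, onTerm_weaken]

theorem onTerm_snoc (ι : L₀ →ᴸ L) (σ : Fin n → Tm L₀ m) (t : Tm L₀ m) :
    (fun i => ι.onTerm (Fin.snoc (α := fun _ => Tm L₀ m) σ t i)) =
      Fin.snoc (α := fun _ => Tm L m) (fun i => ι.onTerm (σ i)) (ι.onTerm t) := by
  funext i
  refine Fin.lastCases ?_ (fun j => ?_) i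
  · simp only [Fin.snoc_last]
  · simp only [Fin.snoc_castSucc]

theorem onBoundedFormula_inst (ι : L₀ →ᴸ L) (σ : Fin n → Tm L₀ m) (A : Fml L₀ n) :
    ι.onBoundedFormula (Fml.inst σ A) =
      Fml.inst (fun i => ι.onTerm (σ i)) (ι.onBoundedFormula A) := by
  induction A generalizing m with
  | falsum => rfl
  | equal t s =>
    exact congrArg₂ BoundedFormula.equal (onTerm_inst ι σ t) (onTerm_inst ι σ s)
  | rel R ts =>
    exact congrArg (BoundedFormula.rel (ι.onRelation R)) (funext fun i => onTerm_inst ι σ (ts i))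
  | imp A B ihA ihB => exact congrArg₂ BoundedFormula.imp (ihA σ) (ihB σ)
  | all A ih =>
    refine congrArg BoundedFormula.all ((ih _).trans ?_)
    rw [onTerm_liftSubst]

theorem onBoundedFormula_weaken (ι : L₀ →ᴸ L) (A : Fml L₀ n) :
    ι.onBoundedFormula A.weaken = Fml.weaken (ι.onBoundedFormula A) :=
  onBoundedFormula_inst ι _ A

theorem onBoundedFormula_instLast (ι : L₀ →ᴸ L) (t : Tm L₀ n) (A : Fml L₀ (n + 1)) :
    ι.onBoundedFormula (Fml.instLast t A) =
      Fml.instLast (ι.onTerm t) (ι.onBoundedFormula A) := by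
  rw [Fml.instLast, onBoundedFormula_inst, onTerm_snoc]
  rfl

end Translation

/-! ### Admissible rules of natural deduction. -/

namespace Derivable

section

variable {L : FirstOrder.Language.{u, v}} {T : L.Theory} {n m : ℕ} {Γ Δ : List (Fml L n)}
  {A B C : Fml L n}

theorem mono (h : Derivable T Γ A) (hΓ : Γ ⊆ Δ) : Derivable T Δ A := by
  induction h with
  | theoryAx h => exact theoryAx h
  | hyp h => exact hyp (hΓ h)
  | impIntro _ ih => exact impIntro (ih (List.cons_subset_cons _ hΓ))
  | impElim _ _ ih₁ ih₂ => exact impElim (ih₁ hΓ) (ih₂ hΓ)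
  | byContra _ ih => exact byContra (ih (List.cons_subset_cons _ hΓ))
  | allIntro _ ih => exact allIntro (ih (List.map_subset _ hΓ))
  | allElim t _ ih => exact allElim t (ih hΓ)
  | eqRefl t => exact eqRefl t
  | eqElim A _ _ ih₁ ih₂ => exact eqElim A (ih₁ hΓ) (ih₂ hΓ)

/-- Every rule is stable under substitution: free variables act as parameters, and axioms are
closed. This yields both weakening by a fresh variable and the use of a closed theorem in an
arbitrary context. -/
theorem subst (h : Derivable T Γ A) (σ : Fin n → Tm L m) :
    Derivable T (Γ.map (Fml.inst σ)) (Fml.inst σ A) := by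
  induction h generalizing m with
  | theoryAx h =>
    rw [Fml.inst_inst, Subsingleton.elim (fun i => Tm.inst σ (Fin.elim0 i)) Fin.elim0]
    exact theoryAx h
  | hyp h => exact hyp (List.mem_map_of_mem h)
  | impIntro _ ih => exact impIntro (ih σ)
  | impElim _ _ ih₁ ih₂ => exact impElim (ih₁ σ) (ih₂ σ)
  | byContra _ ih => exact byContra (ih σ)
  | allIntro _ ih =>
    refine allIntro ?_
    have := ih (liftSubst σ)
    rw [List.map_map] at this ⊢
    convert this using 2
    exact funext fun B => (Fml.inst_liftSubst_weaken σ B).symm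
  | allElim t _ ih =>
    rw [Fml.inst_instLast]
    exact allElim _ (ih σ)
  | eqRefl t => exact eqRefl _
  | eqElim A _ _ ih₁ ih₂ =>
    rw [Fml.inst_instLast]
    refine eqElim _ (ih₁ σ) ?_
    rw [← Fml.inst_instLast]
    exact ih₂ σ

theorem weaken (h : Derivable T Γ A) : Derivable T (Γ.map Fml.weaken) A.weaken :=
  h.subst _

theorem cut (h : Derivable T Γ A) (h' : Derivable T (A :: Γ) B) : Derivable T Γ B :=
  impElim (impIntro h') h

theorem weakenHyp (h : Derivable T Γ A) : Derivable T (B :: Γ) A :=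
  h.mono (List.subset_cons_self _ _)

theorem head : Derivable T (A :: Γ) A := hyp List.mem_cons_self

theorem exfalso (h : Derivable T Γ .falsum) : Derivable T Γ A :=
  byContra h.weakenHyp

theorem notElim (h : Derivable T Γ A.not) (h' : Derivable T Γ A) : Derivable T Γ B :=
  exfalso (impElim h h')

theorem andIntro (hA : Derivable T Γ A) (hB : Derivable T Γ B) : Derivable T Γ (A ⊓ B) :=
  impIntro (impElim (impElim head hA.weakenHyp) hB.weakenHyp)

theorem orInl (hA : Derivable T Γ A) : Derivable T Γ (A ⊔ B) :=
  impIntro (notElim head hA.weakenHyp)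

theorem orInr (hB : Derivable T Γ B) : Derivable T Γ (A ⊔ B) :=
  impIntro hB.weakenHyp

/-- The disjunction unfolds to `¬A ⟹ B`. Assuming `¬C`, the first case refutes `A`, hence `B` holds
and the second case gives `C`. -/
theorem orElim (h : Derivable T Γ (A ⊔ B)) (hA : Derivable T (A :: Γ) C)
    (hB : Derivable T (B :: Γ) C) : Derivable T Γ C := by
  refine byContra (impElim head ?_)
  refine cut (A := B) (impElim h.weakenHyp ?_) ?_
  · refine impIntro (impElim (A := C) (weakenHyp head) (hA.mono ?_))
    exact List.cons_subset_cons _ (List.subset_cons_self _ _)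
  · exact hB.mono (List.cons_subset_cons _ (List.subset_cons_self _ _))

theorem exIntro {A : Fml L (n + 1)} (t : Tm L n) (h : Derivable T Γ (Fml.instLast t A)) :
    Derivable T Γ A.ex :=
  impIntro (impElim (allElim (A := A.not) t head) h.weakenHyp)

theorem exElim {A : Fml L (n + 1)} (h : Derivable T Γ A.ex)
    (h' : Derivable T (A :: Γ.map Fml.weaken) C.weaken) : Derivable T Γ C := by
  refine byContra (impElim (A := A.not.all) h.weakenHyp (allIntro (impIntro ?_)))
  refine impElim (A := C.weaken) (hyp ?_) (h'.mono ?_)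
  · simp only [List.map_cons, List.mem_cons]
    exact Or.inr (Or.inl rfl)
  · exact List.cons_subset_cons _ (List.subset_cons_self _ _)

theorem eqElim_snoc {k : ℕ} (ρ : Fin k → Tm L n) (E : Fml L (k + 1)) {t s : Tm L n}
    (h : Derivable T Γ (.equal t s))
    (h' : Derivable T Γ (Fml.inst (Fin.snoc (α := fun _ => Tm L n) ρ t) E)) :
    Derivable T Γ (Fml.inst (Fin.snoc (α := fun _ => Tm L n) ρ s) E) := by
  rw [← Fml.instLast_inst_liftSubst] at h' ⊢
  exact eqElim _ h h'

/-- The values of `τ` beyond those of `σ` are the witnesses. The innermost quantifier binds the last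
variable, so its witness is the last value of `τ`, and the recursion handles the truncated `τ`. -/
theorem exBlock_intro {k N : ℕ} {Γ : List (Fml L N)} (σ : Fin k → Tm L N) :
    ∀ (m : ℕ) (A : Fml L (k + m)) (τ : Fin (k + m) → Tm L N),
      (∀ i, τ (Fin.castAdd m i) = σ i) → Derivable T Γ (Fml.inst τ A) →
        Derivable T Γ (Fml.inst σ (exBlock m A))
  | 0, A, τ, hτ, h => by
    obtain rfl : τ = σ := funext hτ
    exact h
  | m + 1, A, τ, hτ, h => by
    refine exBlock_intro σ m _ (fun i => τ i.castSucc) (fun i => hτ i) ?_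
    refine exIntro (τ (Fin.last (k + m))) ?_
    show Derivable T Γ (Fml.instLast _ (Fml.inst (liftSubst _) A))
    rw [Fml.instLast_inst_liftSubst]
    exact (Fin.snoc_init_self (α := fun _ => Tm L N) τ).symm ▸ h

theorem foldr_inf {ι : Type*} {D : Fml L n} (l : List ι) (F : ι → Fml L n)
    (h : ∀ i ∈ l, Derivable T Γ (F i)) (hD : Derivable T Γ D) :
    Derivable T Γ ((l.map F).foldr (· ⊓ ·) D) := by
  induction l with
  | nil => exact hD
  | cons a l ih =>
    exact andIntro (h a List.mem_cons_self) (ih fun i hi => h i (List.mem_cons_of_mem _ hi))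

end

/-- All rules commute with the translation; only the axioms of `T₀` need an argument, and each is
replaced by its derivation in `T`. -/
theorem translate {L : FirstOrder.Language.{u, v}} {L₀ : FirstOrder.Language.{0, 0}}
    (ι : L₀ →ᴸ L) {T₀ : L₀.Theory} {T : L.Theory}
    (hT : ∀ A ∈ T₀, Provable T (ι.onSentence A)) {n : ℕ} {Γ : List (Fml L₀ n)} {A : Fml L₀ n}
    (h : Derivable T₀ Γ A) :
    Derivable T (Γ.map ι.onBoundedFormula) (ι.onBoundedFormula A) := by
  induction h with
  | theoryAx h =>
    rw [onBoundedFormula_inst]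
    exact ((hT _ h).subst _).mono (List.nil_subset _)
  | hyp h => exact hyp (List.mem_map_of_mem h)
  | impIntro _ ih => exact impIntro ih
  | impElim _ _ ih₁ ih₂ => exact impElim ih₁ ih₂
  | byContra _ ih => exact byContra ih
  | allIntro _ ih =>
    refine allIntro ?_
    rw [List.map_map] at ih ⊢
    convert ih using 2
    exact funext fun B => (onBoundedFormula_weaken ι B).symm
  | allElim t _ ih =>
    rw [onBoundedFormula_instLast]
    exact allElim _ ih
  | eqRefl t => exact eqRefl _
  | eqElim A _ _ ih₁ ih₂ =>
    rw [onBoundedFormula_instLast] at ih₂ ⊢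
    exact eqElim _ ih₁ ih₂

end Derivable

end WeakRepresentation

namespace WeakRepresentation

/-! ### Truth in a structure and soundness. -/

section Semantics

variable {L : FirstOrder.Language.{u, v}} {M : Type*} [L.Structure M] {n m : ℕ}

/-- The value of a term at an assignment of its variables. -/
def Tm.val (t : Tm L n) (x : Fin n → M) : M := t.realize (Sum.elim Empty.elim x)

/-- The truth of a proposition at an assignment of its free variables. -/
def Fml.Holds (A : Fml L n) (x : Fin n → M) : Prop := A.Realize Empty.elim x

theorem Tm.val_vr (i : Fin n) (x : Fin n → M) : (vr i : Tm L n).val x = x i := rfl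

theorem Tm.val_inst (σ : Fin n → Tm L m) (t : Tm L n) (x : Fin m → M) :
    (Tm.inst σ t).val x = t.val fun i => (σ i).val x := by
  induction t with
  | var a => rcases a with e | i
             · exact e.elim
             · rfl
  | func f ts ih => exact congrArg (Structure.funMap f) (funext ih)

theorem Tm.val_weaken (t : Tm L n) (x : Fin (n + 1) → M) :
    t.weaken.val x = t.val fun i => x i.castSucc := by
  rw [Tm.weaken_eq_inst, Tm.val_inst]
  rfl

theorem val_liftSubst (σ : Fin n → Tm L m) (x : Fin m → M) (a : M) :
    (fun i => (liftSubst σ i).val (Fin.snoc (α := fun _ => M) x a)) =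
      Fin.snoc (α := fun _ => M) (fun i => (σ i).val x) a := by
  funext i
  refine Fin.lastCases ?_ (fun j => ?_) i
  · simp [Tm.val_vr]
  · simp [Tm.val_weaken]

theorem val_snoc (σ : Fin n → Tm L m) (t : Tm L m) (x : Fin m → M) :
    (fun i => (Fin.snoc (α := fun _ => Tm L m) σ t i : Tm L m).val x) =
      Fin.snoc (α := fun _ => M) (fun i => (σ i).val x) (t.val x) := by
  funext i
  refine Fin.lastCases ?_ (fun j => ?_) i
  · simp
  · simp

theorem Fml.holds_imp (A B : Fml L n) (x : Fin n → M) :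
    Fml.Holds (A.imp B) x ↔ (A.Holds x → B.Holds x) := Iff.rfl

theorem Fml.holds_inf (A B : Fml L n) (x : Fin n → M) :
    (A ⊓ B).Holds x ↔ (A.Holds x ∧ B.Holds x) := BoundedFormula.realize_inf

theorem Fml.holds_sup (A B : Fml L n) (x : Fin n → M) :
    (A ⊔ B).Holds x ↔ (A.Holds x ∨ B.Holds x) := BoundedFormula.realize_sup

theorem Fml.holds_all (A : Fml L (n + 1)) (x : Fin n → M) :
    Fml.Holds A.all x ↔ ∀ a, A.Holds (Fin.snoc (α := fun _ => M) x a) := Iff.rfl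

theorem Fml.holds_ex (A : Fml L (n + 1)) (x : Fin n → M) :
    Fml.Holds A.ex x ↔ ∃ a, A.Holds (Fin.snoc (α := fun _ => M) x a) := BoundedFormula.realize_ex

theorem Fml.holds_equal (t s : Tm L n) (x : Fin n → M) :
    Fml.Holds (BoundedFormula.equal t s) x ↔ t.val x = s.val x := Iff.rfl

theorem Fml.holds_inst (σ : Fin n → Tm L m) (A : Fml L n) (x : Fin m → M) :
    (Fml.inst σ A).Holds x ↔ A.Holds fun i => (σ i).val x := by
  induction A generalizing m with
  | falsum => rfl
  | equal t s => simp [Fml.inst, Fml.holds_equal, Tm.val_inst]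
  | rel R ts =>
    exact iff_of_eq (congrArg (Structure.RelMap R) (funext fun i => Tm.val_inst σ (ts i) x))
  | imp A B ihA ihB => exact imp_congr (ihA σ x) (ihB σ x)
  | all A ih =>
    refine forall_congr' fun a => (ih _ _).trans ?_
    rw [val_liftSubst]
    rfl

theorem Fml.holds_instLast (t : Tm L n) (A : Fml L (n + 1)) (x : Fin n → M) :
    (Fml.instLast t A).Holds x ↔ A.Holds (Fin.snoc (α := fun _ => M) x (t.val x)) := by
  rw [Fml.instLast, Fml.holds_inst, val_snoc]
  rfl

theorem Fml.holds_weaken (A : Fml L n) (x : Fin n → M) (a : M) :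
    A.weaken.Holds (Fin.snoc (α := fun _ => M) x a) ↔ A.Holds x := by
  simp [Fml.weaken, Fml.holds_inst, Tm.val_vr]

theorem Derivable.sound {T : L.Theory} (hT : M ⊨ T) {Γ : List (Fml L n)} {A : Fml L n}
    (h : Derivable T Γ A) (x : Fin n → M) (hΓ : ∀ B ∈ Γ, B.Holds x) : A.Holds x := by
  induction h with
  | @theoryAx n Γ A h =>
    rw [Fml.holds_inst]
    have := hT.realize_of_mem A h
    unfold Sentence.Realize Formula.Realize at this
    unfold Fml.Holds
    convert this
  | hyp h => exact hΓ _ h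
  | impIntro _ ih => exact fun hA => ih x (List.forall_mem_cons.2 ⟨hA, hΓ⟩)
  | impElim _ _ ih₁ ih₂ => exact ih₁ x hΓ (ih₂ x hΓ)
  | byContra _ ih => exact by_contra fun hA => ih x (List.forall_mem_cons.2 ⟨hA, hΓ⟩)
  | allIntro _ ih =>
    intro a
    refine ih _ fun B hB => ?_
    obtain ⟨C, hC, rfl⟩ := List.mem_map.1 hB
    exact (Fml.holds_weaken C x a).2 (hΓ C hC)
  | allElim t _ ih => exact (Fml.holds_instLast _ _ _).2 (ih x hΓ _)
  | eqRefl t => exact rfl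
  | eqElim A _ _ ih₁ ih₂ =>
    have h₁ := (Fml.holds_equal _ _ _).1 (ih₁ x hΓ)
    have h₂ := ih₂ x hΓ
    rw [Fml.holds_instLast] at h₂ ⊢
    rwa [← h₁]

theorem Fml.holds_exBlock {k : ℕ} (x : Fin k → M) : ∀ (m : ℕ) (A : Fml L (k + m)),
    (exBlock m A).Holds x ↔ ∃ w : Fin m → M, A.Holds (Fin.append x w)
  | 0, A => by
    simp only [exBlock, Fin.append_right_nil, Unique.exists_iff]
    rfl
  | m + 1, A => by
    -- The value bound by the innermost quantifier is the last entry of the whole block of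
    -- witnesses.
    have e : ∀ (w : Fin m → M) (a : M), Fin.append x (Fin.snoc (α := fun _ => M) w a) =
        Fin.snoc (α := fun _ => M) (Fin.append x w) a := by
      intro w a
      funext i
      refine Fin.lastCases ?_ (fun j => Fin.addCases (fun j => ?_) (fun j => ?_) j) i
      · refine Eq.trans ?_ (Fin.snoc_last (α := fun _ => M) _ _).symm
        exact (Fin.append_right x _ (Fin.last m)).trans (by simp)
      · refine Eq.trans ?_ (Fin.snoc_castSucc (α := fun _ => M) _ _ _).symm
        rw [Fin.append_left]
        exact Fin.append_left x (Fin.snoc (α := fun _ => M) w a) j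
      · refine Eq.trans ?_ (Fin.snoc_castSucc (α := fun _ => M) _ _ _).symm
        rw [Fin.append_right]
        exact (Fin.append_right x (Fin.snoc (α := fun _ => M) w a) j.castSucc).trans (by simp)
    rw [exBlock, Fml.holds_exBlock x m]
    refine (exists_congr fun w => Fml.holds_ex A (Fin.append x w)).trans ?_
    constructor
    · rintro ⟨w, a, h⟩
      exact ⟨Fin.snoc (α := fun _ => M) w a, (e w a).symm ▸ h⟩
    · rintro ⟨w, h⟩
      refine ⟨Fin.init w, w (Fin.last m), ?_⟩
      rw [← e, Fin.snoc_init_self]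
      exact h

theorem Fml.holds_foldr_inf {ι : Type*} (l : List ι) (F : ι → Fml L n) (D : Fml L n)
    (x : Fin n → M) :
    ((l.map F).foldr (· ⊓ ·) D).Holds x ↔ (∀ i ∈ l, (F i).Holds x) ∧ D.Holds x := by
  induction l with
  | nil => simp
  | cons a l ih => simp [Fml.holds_inf, ih, and_assoc]

end Semantics

/-! ### In the standard model the representing proposition defines the graph. -/

section Standard

variable {n : ℕ}

theorem val_tZero (x : Fin n → ℕ) : (tZero : Tm arith n).val x = 0 := rfl

theorem val_tSucc (t : Tm arith n) (x : Fin n → ℕ) : (tSucc t).val x = t.val x + 1 := rfl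

theorem val_tAdd (t s : Tm arith n) (x : Fin n → ℕ) :
    (tAdd t s).val x = t.val x + s.val x := rfl

theorem val_tMul (t s : Tm arith n) (x : Fin n → ℕ) :
    (tMul t s).val x = t.val x * s.val x := rfl

theorem val_numeral (k : ℕ) (x : Fin n → ℕ) : (numeral k : Tm arith n).val x = k := by
  induction k with
  | zero => rfl
  | succ k ih => rw [numeral, val_tSucc, ih]

theorem holds_eqFormula (t s : Tm arith n) (x : Fin n → ℕ) :
    (eqFormula t s).Holds x ↔ t.val x = s.val x := Iff.rfl

theorem holds_leFormula (t s : Tm arith n) (x : Fin n → ℕ) :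
    (leFormula t s).Holds x ↔ t.val x ≤ s.val x := by
  simp [leFormula, Fml.holds_ex, holds_eqFormula, val_tAdd, Tm.val_weaken, Tm.val_vr,
    le_iff_exists_add', eq_comm]

theorem holds_ltFormula (t s : Tm arith n) (x : Fin n → ℕ) :
    (ltFormula t s).Holds x ↔ t.val x < s.val x := by
  rw [ltFormula, holds_leFormula, val_tSucc, Nat.succ_le_iff]

theorem Program.holds_formula : ∀ {n : ℕ} (f : Program n) (x : Fin n → ℕ) (y : ℕ),
    f.formula.Holds (Fin.snoc (α := fun _ => ℕ) x y) ↔ y ∈ f.eval x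
  | _, proj i, x, y => by
    simp [formula, eval, holds_eqFormula, Tm.val_vr]
  | _, zero n, x, y => by
    simp [formula, eval, holds_eqFormula, Tm.val_vr, val_tZero]
  | _, succ, x, y => by
    simp [formula, eval, holds_eqFormula, Tm.val_vr, val_tSucc, Fin.snoc]
  | _, add, x, y => by
    simp [formula, eval, holds_eqFormula, Tm.val_vr, val_tAdd, Fin.snoc]
  | _, mul, x, y => by
    simp [formula, eval, holds_eqFormula, Tm.val_vr, val_tMul, Fin.snoc]
  | _, chiLe, x, y => by
    have h0 : Fin.snoc (α := fun _ => ℕ) x y 0 = x 0 := rfl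
    have h1 : Fin.snoc (α := fun _ => ℕ) x y 1 = x 1 := rfl
    have h2 : Fin.snoc (α := fun _ => ℕ) x y 2 = y := rfl
    simp only [formula, eval, Fml.holds_sup, Fml.holds_inf, holds_eqFormula, holds_leFormula,
      holds_ltFormula, Tm.val_vr, val_numeral, h0, h1, h2, Part.mem_some_iff]
    split_ifs <;> omega
  | _, comp (n := n) (m := m) h g, x, y => by
    simp only [formula, eval, Fml.holds_exBlock, Fml.holds_foldr_inf, Fml.holds_inst, val_snoc,
      Tm.val_vr, Fin.append_left, Fin.append_right, Fin.snoc_castSucc, Fin.snoc_last,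
      List.mem_finRange, true_imp_iff, holds_formula, Part.mem_bind_iff]
    -- Values `w` with each `w i` in the inner evaluation at `i` form exactly the value of the tuple
    -- of inner evaluations.
    refine exists_congr fun w => and_congr_left fun _ => ?_
    constructor
    · intro hw
      exact ⟨fun i => (hw i).1, funext fun i => (hw i).2⟩
    · rintro ⟨d, rfl⟩ i
      exact Part.get_mem (d i)
  | _, mu (n := n) g, x, y => by
    have hx : ∀ a b : ℕ, ∀ j : Fin n,
      Fin.snoc (α := fun _ => ℕ) (Fin.snoc (α := fun _ => ℕ) (Fin.snoc (α := fun _ => ℕ) x y) a) b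
        (Fin.castAdd 3 j) = x j := by
      intro a b j
      rw [show Fin.castAdd 3 j = j.castSucc.castSucc.castSucc from rfl]
      simp only [Fin.snoc_castSucc]
    have hx' : ∀ j : Fin n, Fin.snoc (α := fun _ => ℕ) x y (Fin.castAdd 1 j) = x j :=
      fun j => Fin.snoc_castSucc (α := fun _ => ℕ) _ _ _
    simp only [formula, eval, Fml.holds_inf, Fml.holds_all, Fml.holds_imp, Fml.holds_ex,
      Fml.holds_inst, holds_ltFormula, val_snoc, Tm.val_vr, val_tSucc, val_tZero, hx, hx',
      Fin.snoc_castSucc, Fin.snoc_last, holds_formula]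
    rw [and_comm]
    refine Iff.trans ?_ Nat.mem_rfind.symm
    simp only [Part.mem_map_iff]
    -- The search passes `z` when the value there is defined and nonzero, that is, of the form `w +
    -- 1`.
    refine and_congr ?_ (forall_congr' fun z => imp_congr_right fun _ => ?_)
    · simp
    · constructor
      · rintro ⟨w, hw⟩
        exact ⟨_, hw, by simp⟩
      · rintro ⟨w, hw, hw'⟩
        obtain ⟨w, rfl⟩ := Nat.exists_eq_succ_of_ne_zero (of_decide_eq_false hw')
        exact ⟨w, hw⟩

theorem holds_atNumerals {A : Fml arith (n + 1)} (p : Fin n → ℕ) (q : ℕ) (x : Fin 0 → ℕ) :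
    Fml.Holds (atNumerals A p q) x ↔ A.Holds (Fin.snoc (α := fun _ => ℕ) p q) := by
  simp only [atNumerals, Fml.holds_inst, val_numeral]

end Standard

end WeakRepresentation

namespace WeakRepresentation

/-! ### Substitution in arithmetical terms and propositions. -/

section ArithmeticSubstitution

variable {n m : ℕ} (σ : Fin n → Tm arith m)

@[simp] theorem inst_tZero : Tm.inst σ tZero = tZero :=
  congrArg (Term.func (L := arith) ArithFunc.zero) (funext fun i => i.elim0)

@[simp] theorem inst_tSucc (t : Tm arith n) : Tm.inst σ (tSucc t) = tSucc (Tm.inst σ t) :=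
  congrArg (Term.func (L := arith) ArithFunc.succ) (funext fun i => by fin_cases i; rfl)

@[simp] theorem inst_tAdd (t s : Tm arith n) :
    Tm.inst σ (tAdd t s) = tAdd (Tm.inst σ t) (Tm.inst σ s) :=
  congrArg (Term.func (L := arith) ArithFunc.add) (funext fun i => by fin_cases i <;> rfl)

@[simp] theorem inst_tMul (t s : Tm arith n) :
    Tm.inst σ (tMul t s) = tMul (Tm.inst σ t) (Tm.inst σ s) :=
  congrArg (Term.func (L := arith) ArithFunc.mul) (funext fun i => by fin_cases i <;> rfl)

@[simp] theorem inst_numeral (k : ℕ) : Tm.inst σ (numeral k) = numeral k := by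
  induction k with
  | zero => simp [numeral]
  | succ k ih => simp [numeral, ih]

@[simp] theorem weaken_numeral (k : ℕ) : (numeral k : Tm arith n).weaken = numeral k := by
  rw [Tm.weaken_eq_inst, inst_numeral]

@[simp] theorem inst_eqFormula (t s : Tm arith n) :
    Fml.inst σ (eqFormula t s) = eqFormula (Tm.inst σ t) (Tm.inst σ s) := rfl

theorem weaken_eqFormula (t s : Tm arith n) :
    (eqFormula t s).weaken = eqFormula t.weaken s.weaken := by
  simp [Fml.weaken, Tm.weaken_eq_inst]

@[simp] theorem inst_leFormula (t s : Tm arith n) :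
    Fml.inst σ (leFormula t s) = leFormula (Tm.inst σ t) (Tm.inst σ s) := by
  simp [leFormula, Tm.weaken_inst]

@[simp] theorem inst_ltFormula (t s : Tm arith n) :
    Fml.inst σ (ltFormula t s) = ltFormula (Tm.inst σ t) (Tm.inst σ s) := by
  simp [ltFormula]

end ArithmeticSubstitution

namespace Derivable

/-! ### Derived rules for equality. -/

section Equality

variable {n : ℕ} {T : arith.Theory} {Γ : List (Fml arith n)} {t s r : Tm arith n}

theorem eqFormula_refl (t : Tm arith n) : Derivable T Γ (eqFormula t t) := eqRefl t

/-- Replacement of equals in an equation. -/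
theorem eqFormula_replace (a b : Tm arith (n + 1)) (h : Derivable T Γ (eqFormula t s))
    (h' : Derivable T Γ (eqFormula (Tm.inst (Fin.snoc (α := fun _ => Tm arith n) vr t) a)
      (Tm.inst (Fin.snoc (α := fun _ => Tm arith n) vr t) b))) :
    Derivable T Γ (eqFormula (Tm.inst (Fin.snoc (α := fun _ => Tm arith n) vr s) a)
      (Tm.inst (Fin.snoc (α := fun _ => Tm arith n) vr s) b)) :=
  eqElim (eqFormula a b) h h'

theorem eqFormula_symm (h : Derivable T Γ (eqFormula t s)) : Derivable T Γ (eqFormula s t) := by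
  simpa [Tm.inst_eq_self] using
    eqFormula_replace (vr (Fin.last n)) t.weaken h
      (by simpa [Tm.inst_eq_self] using eqFormula_refl t)

theorem eqFormula_trans (h : Derivable T Γ (eqFormula t s)) (h' : Derivable T Γ (eqFormula s r)) :
    Derivable T Γ (eqFormula t r) := by
  simpa [Tm.inst_eq_self] using
    eqFormula_replace t.weaken (vr (Fin.last n)) h' (by simpa [Tm.inst_eq_self] using h)

theorem eqFormula_tSucc (h : Derivable T Γ (eqFormula t s)) :
    Derivable T Γ (eqFormula (tSucc t) (tSucc s)) := by
  simpa [Tm.inst_eq_self] using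
    eqFormula_replace (tSucc t.weaken) (tSucc (vr (Fin.last n))) h
      (by simpa [Tm.inst_eq_self] using eqFormula_refl (tSucc t))

theorem eqFormula_tAdd_left (h : Derivable T Γ (eqFormula t s)) (r : Tm arith n) :
    Derivable T Γ (eqFormula (tAdd t r) (tAdd s r)) := by
  simpa [Tm.inst_eq_self] using
    eqFormula_replace (tAdd t r).weaken (tAdd (vr (Fin.last n)) r.weaken) h
      (by simpa [Tm.inst_eq_self] using eqFormula_refl (tAdd t r))

theorem eqFormula_tAdd_right (h : Derivable T Γ (eqFormula t s)) (r : Tm arith n) :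
    Derivable T Γ (eqFormula (tAdd r t) (tAdd r s)) := by
  simpa [Tm.inst_eq_self] using
    eqFormula_replace (tAdd r t).weaken (tAdd r.weaken (vr (Fin.last n))) h
      (by simpa [Tm.inst_eq_self] using eqFormula_refl (tAdd r t))

end Equality

/-! ### Derivations in Robinson's arithmetic. -/

section Robinson

variable {n : ℕ} {Γ : List (Fml arith n)}

theorem of_all_mem {T : arith.Theory} {A : Fml arith 1} (h : A.all ∈ T) (t : Tm arith n) :
    Derivable T Γ (Fml.inst ![t] A) := by
  have := allElim t (theoryAx (Γ := Γ) h)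
  rw [Fml.instLast_inst_liftSubst] at this
  convert this using 2
  funext i
  fin_cases i
  rfl

theorem of_all_all_mem {T : arith.Theory} {A : Fml arith 2} (h : A.all.all ∈ T)
    (t s : Tm arith n) : Derivable T Γ (Fml.inst ![t, s] A) := by
  have := allElim t (theoryAx (Γ := Γ) h)
  rw [Fml.instLast_inst_liftSubst] at this
  have := allElim s this
  rw [Fml.instLast_inst_liftSubst] at this
  convert this using 2
  funext i
  fin_cases i <;> rfl

theorem tSucc_ne_tZero (t : Tm arith n) :
    Derivable robinson Γ (eqFormula (tSucc t) tZero).not := by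
  simpa using of_all_mem (Γ := Γ) (T := robinson)
    (A := (eqFormula (tSucc (vr (0 : Fin 1))) tZero).not) (by simp [robinson]) t

theorem tSucc_inj {t s : Tm arith n} (h : Derivable robinson Γ (eqFormula (tSucc t) (tSucc s))) :
    Derivable robinson Γ (eqFormula t s) := by
  refine impElim ?_ h
  simpa using of_all_all_mem (Γ := Γ) (T := robinson)
    (A := (eqFormula (tSucc (vr (0 : Fin 2))) (tSucc (vr 1))).imp (eqFormula (vr 0) (vr 1)))
    (by simp [robinson]) t s

theorem zero_or_tSucc (t : Tm arith n) :
    Derivable robinson Γ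
      (eqFormula t tZero ⊔ (eqFormula t.weaken (tSucc (vr (Fin.last n)))).ex) := by
  have h0 : liftSubst ![t] 0 = t.weaken := rfl
  have h1 : liftSubst ![t] 1 = vr (Fin.last n) := rfl
  simpa [h0, h1] using of_all_mem (Γ := Γ) (T := robinson)
    (A := eqFormula (vr (0 : Fin 1)) tZero ⊔
      (eqFormula (vr (0 : Fin 2)) (tSucc (vr 1))).ex) (by simp [robinson]) t

theorem tAdd_tZero (t : Tm arith n) : Derivable robinson Γ (eqFormula (tAdd t tZero) t) := by
  simpa using of_all_mem (Γ := Γ) (T := robinson)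
    (A := eqFormula (tAdd (vr (0 : Fin 1)) tZero) (vr 0)) (by simp [robinson]) t

theorem tAdd_tSucc (t s : Tm arith n) :
    Derivable robinson Γ (eqFormula (tAdd t (tSucc s)) (tSucc (tAdd t s))) := by
  simpa using of_all_all_mem (Γ := Γ) (T := robinson)
    (A := eqFormula (tAdd (vr (0 : Fin 2)) (tSucc (vr 1))) (tSucc (tAdd (vr 0) (vr 1))))
    (by simp [robinson]) t s

theorem tMul_tZero (t : Tm arith n) : Derivable robinson Γ (eqFormula (tMul t tZero) tZero) := by
  simpa using of_all_mem (Γ := Γ) (T := robinson)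
    (A := eqFormula (tMul (vr (0 : Fin 1)) tZero) tZero) (by simp [robinson]) t

theorem tMul_tSucc (t s : Tm arith n) :
    Derivable robinson Γ (eqFormula (tMul t (tSucc s)) (tAdd (tMul t s) t)) := by
  simpa using of_all_all_mem (Γ := Γ) (T := robinson)
    (A := eqFormula (tMul (vr (0 : Fin 2)) (tSucc (vr 1))) (tAdd (tMul (vr 0) (vr 1)) (vr 0)))
    (by simp [robinson]) t s

theorem numeral_add (a b : ℕ) :
    Derivable robinson Γ (eqFormula (tAdd (numeral a) (numeral b)) (numeral (a + b))) := by
  induction b with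
  | zero => exact tAdd_tZero _
  | succ b ih => exact (tAdd_tSucc _ _).eqFormula_trans ih.eqFormula_tSucc

theorem numeral_mul (a b : ℕ) :
    Derivable robinson Γ (eqFormula (tMul (numeral a) (numeral b)) (numeral (a * b))) := by
  induction b with
  | zero => exact tMul_tZero _
  | succ b ih =>
    exact (tMul_tSucc _ _).eqFormula_trans
      ((ih.eqFormula_tAdd_left _).eqFormula_trans (numeral_add _ _))

theorem numeral_le {a b : ℕ} (h : a ≤ b) :
    Derivable robinson Γ (leFormula (numeral a) (numeral b)) := by
  -- `a ≤ b` unfolds to `∃ z, z + a = b`.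
  refine exIntro (numeral (b - a)) ?_
  simpa [Fml.instLast, Nat.sub_add_cancel h] using numeral_add (Γ := Γ) (b - a) a

/-- Case distinction on a number smaller than a numeral. -/
theorem cases_lt_numeral (q : ℕ) : ∀ {n : ℕ} {Γ : List (Fml arith n)} {C : Fml arith n}
    {t u : Tm arith n}, Derivable robinson Γ (eqFormula (tAdd u (tSucc t)) (numeral q)) →
    (∀ j < q, Derivable robinson (eqFormula t (numeral j) :: Γ) C) → Derivable robinson Γ C := by
  induction q with
  | zero =>
    intro n Γ C t u h _
    -- `S(u + t) = u + S(t) = 0` is absurd.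
    exact (tSucc_ne_tZero _).notElim ((tAdd_tSucc u t).eqFormula_symm.eqFormula_trans h)
  | succ q ih =>
    intro n Γ C t u h hC
    have h' : Derivable robinson Γ (eqFormula (tAdd u t) (numeral q)) :=
      tSucc_inj ((tAdd_tSucc u t).eqFormula_symm.eqFormula_trans h)
    -- If `t = S(w)`, then `u + S(w) = q`, so the induction hypothesis applies to `w` with the same
    -- `u`; its case `w = j` is the case `t = j + 1`.
    refine (zero_or_tSucc t).orElim (hC 0 q.succ_pos) (exElim head ?_)
    have hw : ∀ {B : Fml arith n} {D D' : Fml arith (n + 1)}, Derivable robinson Γ B →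
        Derivable robinson (D :: (D' :: Γ.map Fml.weaken)) B.weaken :=
      fun hB => hB.weaken.weakenHyp.weakenHyp
    have h'' := hw (D := eqFormula t.weaken (tSucc (vr (Fin.last n))))
      (D' := Fml.weaken (eqFormula t.weaken (tSucc (vr (Fin.last n)))).ex) h'
    refine ih (t := vr (Fin.last n)) (u := u.weaken) ?_ fun j hj => ?_
    · refine (eqFormula_tAdd_right (eqFormula_symm head) _).eqFormula_trans ?_
      simpa [Fml.weaken, ← Tm.weaken_eq_inst] using h''
    · have h₁ := (hC (j + 1) (Nat.succ_lt_succ hj)).weaken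
      rw [List.map_cons, weaken_eqFormula, weaken_numeral] at h₁
      refine cut (A := eqFormula t.weaken (numeral (j + 1))) ?_ (h₁.mono ?_)
      · exact (weakenHyp head).eqFormula_trans (eqFormula_tSucc head)
      · intro B hB
        rcases List.mem_cons.1 hB with rfl | hB
        · simp
        · simp only [List.map_cons, List.mem_cons]
          tauto

theorem numeral_snoc {k : ℕ} (p : Fin k → ℕ) (j : ℕ) :
    (fun i => (numeral (Fin.snoc (α := fun _ => ℕ) p j i) : Tm arith n)) =
      Fin.snoc (α := fun _ => Tm arith n) (fun i => numeral (p i)) (numeral j) := by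
  funext i
  refine Fin.lastCases ?_ (fun j => ?_) i
  · simp
  · simp

/-- The instances are required in every context because they are used below two fresh variables: the
bound `z` and the witness of `z < q`. -/
theorem forall_lt_numeral {k : ℕ} (p : Fin k → ℕ) (q : ℕ) (E : Fml arith (k + 1))
    (h : ∀ j < q, ∀ {n : ℕ} {Γ : List (Fml arith n)},
      Derivable robinson Γ (Fml.inst (fun i => numeral (Fin.snoc (α := fun _ => ℕ) p j i)) E)) :
    Derivable robinson Γ
      ((ltFormula (vr (Fin.last n)) (numeral q)).imp
        (Fml.inst (liftSubst fun i => numeral (p i)) E)).all := by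
  refine allIntro (impIntro (exElim head ?_))
  -- Here `t` is the quantified `z`, and `u` is the witness of the unfolded inequality `∃ u, u +
  -- S(z) = q`.
  refine cases_lt_numeral q (t := vr (Fin.last n).castSucc) (u := vr (Fin.last (n + 1))) ?_
    fun j hj => ?_
  · have e : (tSucc (vr (Fin.last n) : Tm arith (n + 1))).weaken =
        tSucc (vr (Fin.last n).castSucc) := by
      simp [Tm.weaken_eq_inst]
    simp only [weaken_numeral]
    rw [← e]
    exact head
  · have e : (fun i => Tm.weaken (liftSubst (fun i => (numeral (p i) : Tm arith n)) i)) =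
        Fin.snoc (α := fun _ => Tm arith (n + 2)) (fun i => numeral (p i))
          (vr (Fin.last n).castSucc) := by
      funext i
      refine Fin.lastCases ?_ (fun j => ?_) i
      · simp [Tm.weaken_eq_inst]
      · simp
    rw [Fml.weaken_inst, e]
    -- In the case `z = j`, replacing `z` by the numeral leaves the assumed instance.
    refine eqElim_snoc _ _ (eqFormula_symm head) ?_
    rw [← numeral_snoc]
    exact h j hj

/-- Robinson's arithmetic proves the true instances of the proposition representing a program. -/
theorem formula_of_mem_eval : ∀ {k : ℕ} (f : Program k) (p : Fin k → ℕ) (q : ℕ), q ∈ f.eval p →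
    ∀ {n : ℕ} {Γ : List (Fml arith n)},
      Derivable robinson Γ
        (Fml.inst (fun i => numeral (Fin.snoc (α := fun _ => ℕ) p q i)) f.formula)
  | _, .proj i, p, q, hq, n, Γ => by
    obtain rfl := Part.mem_some_iff.1 hq
    simpa [Program.formula] using eqFormula_refl _
  | _, .zero k, p, q, hq, n, Γ => by
    obtain rfl := Part.mem_some_iff.1 hq
    simpa [Program.formula, numeral] using eqFormula_refl tZero
  | _, .succ, p, q, hq, n, Γ => by
    obtain rfl := Part.mem_some_iff.1 hq
    simp only [Program.formula, inst_eqFormula, inst_tSucc, Tm.inst_vr]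
    exact eqFormula_refl _
  | _, .add, p, q, hq, n, Γ => by
    obtain rfl := Part.mem_some_iff.1 hq
    simp only [Program.formula, inst_eqFormula, inst_tAdd, Tm.inst_vr]
    exact (numeral_add (p 0) (p 1)).eqFormula_symm
  | _, .mul, p, q, hq, n, Γ => by
    obtain rfl := Part.mem_some_iff.1 hq
    simp only [Program.formula, inst_eqFormula, inst_tMul, Tm.inst_vr]
    exact (numeral_mul (p 0) (p 1)).eqFormula_symm
  | _, .chiLe, p, q, hq, n, Γ => by
    have h0 : Fin.snoc (α := fun _ => ℕ) p q 0 = p 0 := rfl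
    have h1 : Fin.snoc (α := fun _ => ℕ) p q 1 = p 1 := rfl
    have h2 : Fin.snoc (α := fun _ => ℕ) p q 2 = q := rfl
    simp only [Program.formula, Fml.inst_sup, Fml.inst_inf, inst_leFormula, inst_ltFormula,
      inst_eqFormula, Tm.inst_vr, inst_numeral, h0, h1, h2]
    obtain rfl := Part.mem_some_iff.1 hq
    split_ifs with h
    · exact orInl (andIntro (numeral_le h) (eqFormula_refl _))
    -- The strict inequality is `S(x₂) ≤ x₁`, and the successor of a numeral is by definition the
    -- next numeral.
    · exact orInr (andIntro (numeral_le (a := p 1 + 1) (not_le.1 h)) (eqFormula_refl _))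
  | _, .comp (n := k) (m := m) h g, p, q, hq, n, Γ => by
    obtain ⟨w, ⟨d, rfl⟩, hw⟩ := Part.mem_bind_iff.1 hq
    have hg := fun i => formula_of_mem_eval (g i) p _ (Part.get_mem (d i)) (Γ := Γ)
    have hh := formula_of_mem_eval h _ q hw (Γ := Γ)
    -- The witnesses `w₁, …, wₘ` are the numerals of the inner values.
    refine exBlock_intro _ m _ (Fin.append
      (fun i => numeral (Fin.snoc (α := fun _ => ℕ) p q i))
      (fun i => numeral (((g i).eval p).get (d i)))) (fun i => Fin.append_left _ _ i) ?_
    rw [Fml.inst_foldr_inf]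
    refine foldr_inf _ _ (fun i _ => ?_) ?_
    · simpa [Tm.inst_comp_snoc, numeral_snoc] using hg i
    · simpa [Tm.inst_comp_snoc, numeral_snoc] using hh
  | _, .mu (n := k) g, p, q, hq, n, Γ => by
    obtain ⟨h0, hlt⟩ := Nat.mem_rfind.1 hq
    obtain ⟨w, hw, hw0⟩ := (Part.mem_map_iff _).1 h0
    obtain rfl := of_decide_eq_true hw0
    have hx : ∀ {n : ℕ} (j : Fin k), Fin.snoc (α := fun _ => Tm arith n) (fun i => numeral (p i))
        (numeral q) (Fin.castAdd 1 j) = numeral (p j) :=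
      fun j => Fin.snoc_castSucc (α := fun _ => Tm arith _) _ _ _
    refine andIntro ?_ ?_
    -- The parameters are `p` together with `q`, since `y` is also a variable of the quantified
    -- proposition; `q` serves again as the bound.
    · have := forall_lt_numeral (Γ := Γ) (Fin.snoc (α := fun _ => ℕ) p q) q
        (BoundedFormula.ex (n := k + 2)
            (Fml.inst
              (Fin.snoc (α := fun _ => Tm arith (k + 3))
                (Fin.snoc (α := fun _ => Tm arith (k + 3)) (fun j => vr (Fin.castAdd 3 j))
                  (vr (Fin.last (k + 1)).castSucc))
                (tSucc (vr (Fin.last (k + 2)))))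
              (Program.formula g))) ?_
      · simpa using this
      · intro j hj n Γ
        obtain ⟨w, hw, hw0⟩ := (Part.mem_map_iff _).1 (hlt hj)
        obtain ⟨w, rfl⟩ := Nat.exists_eq_succ_of_ne_zero (of_decide_eq_false hw0)
        -- The value of `g` at `j < q` is nonzero, and the witness is its predecessor.
        refine exIntro (numeral w) ?_
        have := formula_of_mem_eval g _ _ hw (Γ := Γ)
        rw [Fml.instLast_inst_liftSubst]
        simpa [Tm.inst_comp_snoc, numeral_snoc, hx, numeral] using this
    · simpa [Tm.inst_comp_snoc, numeral_snoc, hx, numeral] using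
        formula_of_mem_eval g _ _ hw (Γ := Γ)

end Robinson

end Derivable

end WeakRepresentation

theorem mainTheorem3 {L : FirstOrder.Language.{u, v}}
    (ι : WeakRepresentation.arith →ᴸ L) (T : L.Theory)
    (hdec : WeakRepresentation.HasDecidableAxiomSet T)
    (hext : WeakRepresentation.ExtendsRobinson ι T)
    (hstd : WeakRepresentation.HasStandardModel ι T)
    {n : ℕ} (f : WeakRepresentation.Program n) (p : Fin n → ℕ) (q : ℕ) :
    WeakRepresentation.Provable T
        (ι.onSentence (WeakRepresentation.atNumerals f.formula p q)) ↔
      f.eval p = Part.some q := by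
  rw [Part.eq_some_iff]
  constructor
  · intro h
    obtain ⟨M, hM, hT⟩ := hstd
    have hs := h.sound hT default (by simp)
    -- Since `M` expands the standard structure, truth in `M` of the translated sentence is truth of
    -- the original one in `ℕ`.
    rw [← f.holds_formula, ← WeakRepresentation.holds_atNumerals p q default]
    exact (LHom.realize_onBoundedFormula ι _).1 hs
  · intro h
    exact (WeakRepresentation.Derivable.formula_of_mem_eval f p q h (Γ := [])).translate ι hext
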